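/- Let $\nu, x, \alpha > 0$ and $\mu > \nu/2$ be real numbers. Let ${}_2F_1(a,b;c;z)$ denote the Gauss hypergeometric function, that is, the analytic continuation of $\sum_{k\ge 0} \frac{(a)_k (b)_k}{(c)_k\, k!} z^k$ ($|z|<1$) to $\mathbb{C}\setminus[1,\infty)$. Then both series below converge absolutely, and $$\sum_{n\in\mathbb{Z}} |\Gamma(\mu+i\alpha n)|^2\, {}_2F_1\left(\mu+i\alpha n,\ \mu-i\alpha n;\ \nu;\ -x^2\right) = \frac{\pi}{\alpha}\, 2^{1-2\mu}\,\Gamma(2\mu) \sum_{n\in\mathbb{Z}} \frac{1}{\cosh^{2\mu}\left(\frac{\pi n}{\alpha}\right)}\, {}_2F_1\left(\mu,\ \mu+\tfrac12;\ \nu;\ -\frac{x^2}{\cosh^2\left(\frac{\pi n}{\alpha}\right)}\right).$$ -/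

import Mathlib

/-- The complex plane cut along the half-line `[1, ∞)`. -/
def cutPlane : Set ℂ := {z : ℂ | 1 - z ∈ Complex.slitPlane}

/-- `F` is an analytic continuation of the Gauss series
`∑ₙ (a)ₙ (b)ₙ / ((c)ₙ n!) zⁿ`, `|z| < 1`, to the plane cut along `[1, ∞)`. -/
def IsGaussContinuation (a b c : ℂ) (F : ℂ → ℂ) : Prop :=
  DifferentiableOn ℂ F cutPlane ∧
    ∀ z ∈ Metric.ball (0 : ℂ) 1, F z = ordinaryHypergeometric a b c z

/-- The Gauss hypergeometric function `₂F₁(a, b; c; z)` on the plane cut along `[1, ∞)`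
(principal branch): the analytic continuation of the Gauss series. It is unique on the cut plane,
see `gauss2F1_eq`; the values on the cut itself are not used. -/
noncomputable def gauss2F1 (a b c z : ℂ) : ℂ :=
  Classical.epsilon (IsGaussContinuation a b c) z

theorem cutPlane_isOpen : IsOpen cutPlane :=
  Complex.isOpen_slitPlane.preimage (continuous_const.sub continuous_id)

theorem ball_subset_cutPlane : Metric.ball (0 : ℂ) 1 ⊆ cutPlane := by
  intro z hz
  have h : ‖z‖ < 1 := by simpa using hz
  refine Or.inl ?_
  have := Complex.re_le_norm z
  simp only [Complex.sub_re, Complex.one_re]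
  linarith

theorem cutPlane_isPreconnected : IsPreconnected cutPlane := by
  have h : cutPlane = (fun w : ℂ => 1 - w) '' Complex.slitPlane := by
    ext z
    constructor
    · intro hz
      exact ⟨1 - z, hz, by ring⟩
    · rintro ⟨w, hw, rfl⟩
      simpa [cutPlane] using hw
  rw [h]
  exact (Complex.starConvex_one_slitPlane.isPathConnected (Or.inl (by simp))).isConnected.isPreconnected.image _
    (by fun_prop)

/-- Any analytic continuation of the Gauss series to the cut plane is `gauss2F1` there. -/
theorem gauss2F1_eq {a b c : ℂ} {F : ℂ → ℂ} (hF : IsGaussContinuation a b c F)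
    {z : ℂ} (hz : z ∈ cutPlane) : gauss2F1 a b c z = F z := by
  have hE : IsGaussContinuation a b c (Classical.epsilon (IsGaussContinuation a b c)) :=
    Classical.epsilon_spec ⟨F, hF⟩
  have h0 : (0 : ℂ) ∈ cutPlane := ball_subset_cutPlane (by simp)
  refine (hE.1.analyticOnNhd cutPlane_isOpen).eqOn_of_preconnected_of_eventuallyEq
    (hF.1.analyticOnNhd cutPlane_isOpen) cutPlane_isPreconnected h0 ?_ hz
  filter_upwards [Metric.ball_mem_nhds (0 : ℂ) one_pos] with w hw
  rw [hE.2 w hw, hF.2 w hw]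

/-! The identity is Poisson summation. For μ > 0 and real y, the function |Γ(μ+iy)|² ₂F₁(μ+iy, μ-iy;
c; z) is 2^(1-2μ) Γ(2μ) times the integral over v of e^(2iyv) cosh(v)^(-2μ) ₂F₁(μ, μ+1/2; c; z/cosh²
v) (`norm_Gamma_sq_mul_gauss2F1`). At y = αn and z = -x², the left-hand terms are Fourier
coefficients of the profile sampled on the right.

The representation is checked on Gauss coefficients. The moments of 1/cosh² v against e^(2iyv)
cosh(v)^(-2μ) are Beta values, and the duplication (2μ)_(2k) = 4^k (μ)_k (μ+1/2)_k matches the two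
series. Since 1/cosh² v lies in [0, 1], averaging over such dilations stays inside the cut plane, so
the identity holds there and not just in the unit disc (`IsGaussContinuation.integral`).

The same transport principle, applied to (1-z)^(-a), yields Euler's integral and hence the
continuation itself. Poisson summation applies because the profile is holomorphic and exponentially
small in a horizontal strip (`sech_profile_strip`, `poisson_summation_of_strip`). -/

open MeasureTheory Set Filter Topology

/-! ### Averages over dilations of the cut plane -/

theorem mul_mem_cutPlane {z : ℂ} (hz : z ∈ cutPlane) {t : ℝ} (ht : t ∈ Icc (0 : ℝ) 1) :
    (t : ℂ) * z ∈ cutPlane := by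
  have h := Complex.starConvex_one_slitPlane hz (sub_nonneg.2 ht.2) ht.1 (by ring)
  have e : (1 - t) • (1 : ℂ) + t • (1 - z) = 1 - (t : ℂ) * z := by
    simp only [Complex.real_smul]; push_cast; ring
  rwa [e] at h

theorem aestronglyMeasurable_comp_mul {X : Type*} [MeasurableSpace X] {m : Measure X}
    {r : X → ℝ} (hrm : AEMeasurable r m) (hr : ∀ᵐ t ∂m, r t ∈ Icc (0 : ℝ) 1)
    {H : ℂ → ℂ} (hH : ContinuousOn H cutPlane) {z : ℂ} (hz : z ∈ cutPlane) :
    AEStronglyMeasurable (fun t => H ((r t : ℂ) * z)) m := by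
  -- Clamping to [0, 1] gives a globally continuous function, so continuity of `H` on the cut plane
  -- suffices for measurability.
  have hc : Continuous fun s : ℝ => H (((projIcc (0 : ℝ) 1 zero_le_one s : ℝ) : ℂ) * z) :=
    hH.comp_continuous (by fun_prop) fun s => mul_mem_cutPlane hz (projIcc _ _ _ s).2
  refine (hc.measurable.comp_aemeasurable hrm).aestronglyMeasurable.congr ?_
  filter_upwards [hr] with t ht
  simp [projIcc_of_mem _ ht]

theorem exists_bound_comp_mul {H : ℂ → ℂ} (hH : ContinuousOn H cutPlane) {K : Set ℂ}
    (hK : IsCompact K) (hKs : K ⊆ cutPlane) :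
    ∃ M : ℝ, ∀ t ∈ Icc (0 : ℝ) 1, ∀ z ∈ K, ‖H ((t : ℂ) * z)‖ ≤ M := by
  have hc : ContinuousOn (fun p : ℝ × ℂ => H ((p.1 : ℂ) * p.2)) (Icc (0 : ℝ) 1 ×ˢ K) :=
    hH.comp (by fun_prop) fun p hp => mul_mem_cutPlane (hKs hp.2) hp.1
  obtain ⟨M, hM⟩ := (isCompact_Icc.prod hK).exists_bound_of_continuousOn hc
  exact ⟨M, fun t ht z hz => hM (t, z) ⟨ht, hz⟩⟩

theorem integrable_mul_comp_mul {X : Type*} [MeasurableSpace X] {m : Measure X} {w : X → ℂ}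
    (hw : Integrable w m) {r : X → ℝ} (hrm : AEMeasurable r m)
    (hr : ∀ᵐ t ∂m, r t ∈ Icc (0 : ℝ) 1) {H : ℂ → ℂ} (hH : ContinuousOn H cutPlane)
    {z : ℂ} (hz : z ∈ cutPlane) : Integrable (fun t => w t * H ((r t : ℂ) * z)) m := by
  obtain ⟨M, hM⟩ := exists_bound_comp_mul hH isCompact_singleton (singleton_subset_iff.2 hz)
  refine hw.mul_bdd (c := M) (aestronglyMeasurable_comp_mul hrm hr hH hz) ?_
  filter_upwards [hr] with t ht
  exact hM _ ht _ rfl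

/-- Averages of dilations by factors in `[0, 1]` preserve holomorphy on the cut plane. -/
theorem differentiableOn_integral_mul_comp_mul {X : Type*} [MeasurableSpace X] {m : Measure X}
    {w : X → ℂ} (hw : Integrable w m) {r : X → ℝ} (hrm : AEMeasurable r m)
    (hr : ∀ᵐ t ∂m, r t ∈ Icc (0 : ℝ) 1) {G : ℂ → ℂ} (hG : DifferentiableOn ℂ G cutPlane) :
    DifferentiableOn ℂ (fun z => ∫ t, w t * G ((r t : ℂ) * z) ∂m) cutPlane := by
  intro z₀ hz₀
  obtain ⟨ε, hε, hball⟩ := Metric.nhds_basis_closedBall.mem_iff.1 (cutPlane_isOpen.mem_nhds hz₀)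
  have hG' : ContinuousOn (deriv G) cutPlane := (hG.deriv cutPlane_isOpen).continuousOn
  obtain ⟨M, hM⟩ := exists_bound_comp_mul hG' (isCompact_closedBall z₀ ε) hball
  refine ((hasDerivAt_integral_of_dominated_loc_of_deriv_le (𝕜 := ℂ)
    (bound := fun t => ‖w t‖ * M)
    (F' := fun z t => w t * (deriv G ((r t : ℂ) * z) * (r t : ℂ)))
    (Metric.closedBall_mem_nhds z₀ hε) ?_
    (integrable_mul_comp_mul hw hrm hr hG.continuousOn hz₀) ?_ ?_ (hw.norm.mul_const M)
    ?_).2.differentiableAt).differentiableWithinAt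
  · filter_upwards [cutPlane_isOpen.mem_nhds hz₀] with z hz
    exact (integrable_mul_comp_mul hw hrm hr hG.continuousOn hz).aestronglyMeasurable
  · exact hw.aestronglyMeasurable.mul ((aestronglyMeasurable_comp_mul hrm hr hG' hz₀).mul
      (Complex.measurable_ofReal.comp_aemeasurable hrm).aestronglyMeasurable)
  · filter_upwards [hr] with t ht z hz
    have h1 := hM _ ht _ hz
    have h2 : ‖(r t : ℂ)‖ ≤ 1 := by
      rw [Complex.norm_real, Real.norm_of_nonneg ht.1]; exact ht.2
    rw [norm_mul, norm_mul]
    refine mul_le_mul_of_nonneg_left ?_ (norm_nonneg _)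
    calc _ ≤ ‖deriv G ((r t : ℂ) * z)‖ * 1 := by gcongr
      _ ≤ M := by linarith
  · filter_upwards [hr] with t ht z hz
    have hd : HasDerivAt G (deriv G ((r t : ℂ) * z)) ((r t : ℂ) * z) :=
      (hG.differentiableAt (cutPlane_isOpen.mem_nhds
        (mul_mem_cutPlane (hball hz) ht))).hasDerivAt
    have := hd.comp z ((hasDerivAt_id z).const_mul (r t : ℂ))
    simpa [Function.comp_def] using this.const_mul (w t)

/-! ### The Gauss series and its transport by moments -/

/-- If some parameter is a nonpositive integer, the coefficients eventually vanish (for `c` because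
`0⁻¹ = 0`) and the radius is infinite; otherwise it is 1. -/
theorem one_le_radius_ordinaryHypergeometricSeries (a b c : ℂ) :
    1 ≤ (ordinaryHypergeometricSeries ℂ a b c).radius := by
  by_cases h : ∀ k : ℕ, (k : ℂ) ≠ -a ∧ (k : ℂ) ≠ -b ∧ (k : ℂ) ≠ -c
  · rw [ordinaryHypergeometricSeries_radius_eq_one ℂ a b c h]
  · push Not at h
    obtain ⟨k, hk⟩ := h
    by_cases ha : (k : ℂ) = -a
    · obtain rfl : a = -k := by rw [ha, neg_neg]
      simp [ordinaryHypergeometric_radius_top_of_neg_nat₁]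
    by_cases hb : (k : ℂ) = -b
    · obtain rfl : b = -k := by rw [hb, neg_neg]
      simp [ordinaryHypergeometric_radius_top_of_neg_nat₂]
    obtain rfl : c = -k := by rw [hk ha hb, neg_neg]
    simp [ordinaryHypergeometric_radius_top_of_neg_nat₃]

theorem hasFPowerSeriesOnBall_ordinaryHypergeometric (a b c : ℂ) :
    HasFPowerSeriesOnBall (ordinaryHypergeometric a b c : ℂ → ℂ)
      (ordinaryHypergeometricSeries ℂ a b c) 0 1 :=
  ((ordinaryHypergeometricSeries ℂ a b c).hasFPowerSeriesOnBall
    (one_pos.trans_le (one_le_radius_ordinaryHypergeometricSeries a b c))).mono one_pos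
    (one_le_radius_ordinaryHypergeometricSeries a b c)

theorem hasSum_ordinaryHypergeometric (a b c : ℂ) {z : ℂ} (hz : ‖z‖ < 1) :
    HasSum (fun k => ordinaryHypergeometricCoefficient a b c k * z ^ k)
      (ordinaryHypergeometric a b c z) := by
  have h := (hasFPowerSeriesOnBall_ordinaryHypergeometric a b c).hasSum (y := z)
    (by simpa [Metric.mem_eball, edist_zero_right, enorm_eq_nnnorm, ← NNReal.coe_lt_coe] using hz)
  simpa only [zero_add, ordinaryHypergeometricSeries_apply_eq, smul_eq_mul] using h

theorem summable_norm_ordinaryHypergeometric (a b c : ℂ) {z : ℂ} (hz : ‖z‖ < 1) :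
    Summable fun k => ‖ordinaryHypergeometricCoefficient a b c k * z ^ k‖ :=
  (hasSum_ordinaryHypergeometric a b c hz).summable.norm

/-- If the moments of `w` against powers of `r` turn the Gauss coefficients of `(a, b; c)` into
those of `(a', b'; c')`, then integration against `w` turns the continuations into each other. -/
theorem IsGaussContinuation.integral {X : Type*} [MeasurableSpace X] {m : Measure X}
    {w : X → ℂ} (hw : Integrable w m) {r : X → ℝ} (hrm : AEMeasurable r m)
    (hr : ∀ᵐ t ∂m, r t ∈ Icc (0 : ℝ) 1) {a b c a' b' c' : ℂ} {G : ℂ → ℂ}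
    (hG : IsGaussContinuation a b c G) {M : ℂ} (hM : M ≠ 0)
    (hmom : ∀ k : ℕ, ordinaryHypergeometricCoefficient a' b' c' k * M =
      ordinaryHypergeometricCoefficient a b c k * ∫ t, w t * (r t : ℂ) ^ k ∂m) :
    IsGaussContinuation a' b' c' fun z => M⁻¹ * ∫ t, w t * G ((r t : ℂ) * z) ∂m := by
  refine ⟨(differentiableOn_integral_mul_comp_mul hw hrm hr hG.1).const_mul _, fun z hz => ?_⟩
  have hz' : ‖z‖ < 1 := by simpa using hz
  have hrn : ∀ᵐ t ∂m, ∀ k : ℕ, ‖(r t : ℂ) ^ k‖ ≤ 1 := by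
    filter_upwards [hr] with t ht k
    rw [norm_pow, Complex.norm_real, Real.norm_of_nonneg ht.1]
    exact pow_le_one₀ ht.1 ht.2
  have hcm : ∀ k : ℕ, AEStronglyMeasurable (fun t => (r t : ℂ) ^ k) m := fun k =>
    ((Complex.measurable_ofReal.comp_aemeasurable hrm).pow_const k).aestronglyMeasurable
  have hwk : ∀ k : ℕ, Integrable (fun t => w t * (r t : ℂ) ^ k) m := fun k =>
    hw.mul_bdd (c := 1) (hcm k) (hrn.mono fun t ht => ht k)
  have hs := summable_norm_ordinaryHypergeometric a b c hz'
  -- Termwise integration: since |r^k| ≤ 1, the absolutely convergent series at z itself dominates.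
  have key := hasSum_integral_of_dominated_convergence (μ := m)
    (F := fun k t => ordinaryHypergeometricCoefficient a b c k * z ^ k * (w t * (r t : ℂ) ^ k))
    (f := fun t => w t * G ((r t : ℂ) * z))
    (fun k t => ‖ordinaryHypergeometricCoefficient a b c k * z ^ k‖ * ‖w t‖)
    (fun k => ((hwk k).const_mul _).aestronglyMeasurable)
    (fun k => by
      filter_upwards [hrn] with t ht
      rw [norm_mul, norm_mul (w t)]
      refine mul_le_mul_of_nonneg_left ?_ (norm_nonneg _)
      exact mul_le_of_le_one_right (norm_nonneg _) (ht k))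
    (ae_of_all _ fun t => hs.mul_right _)
    (by simp_rw [tsum_mul_right]; exact hw.norm.const_mul _)
    (by
      filter_upwards [hr] with t ht
      have hb : ‖(r t : ℂ) * z‖ < 1 := by
        rw [norm_mul, Complex.norm_real, Real.norm_of_nonneg ht.1]
        exact (mul_le_of_le_one_left (norm_nonneg _) ht.2).trans_lt hz'
      rw [hG.2 _ (by simpa using hb)]
      convert! (hasSum_ordinaryHypergeometric a b c hb).mul_left (w t) using 1
      funext k
      rw [mul_pow]; ring)
  have h2 := key.unique (a₂ := M * ordinaryHypergeometric a' b' c' z) (by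
    convert! (hasSum_ordinaryHypergeometric a' b' c' hz').mul_left M using 1
    funext k
    rw [integral_const_mul, mul_right_comm, ← hmom k]; ring)
  simp only
  rw [h2, inv_mul_cancel_left₀ hM]

/-! ### Existence of the continuation -/

/-- The binomial series with a cancelling dummy pair (1; 1): the explicit continuation from which
Euler's integral starts. -/
theorem isGaussContinuation_one_sub_cpow (a : ℂ) :
    IsGaussContinuation a 1 1 fun z => (1 - z) ^ (-a) := by
  refine ⟨fun z hz => ?_, fun z hz => ?_⟩
  · exact (DifferentiableAt.cpow_const (by fun_prop) hz).differentiableWithinAt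
  · have hz' : ‖-z‖ < 1 := by simpa using hz
    have hs : binomialSeries ℂ (-a) =
        (ordinaryHypergeometricSeries ℂ (- -a) (1 : ℂ) 1).compContinuousLinearMap (-(.id _ _)) :=
      binomialSeries_eq_ordinaryHypergeometricSeries (a := -a) (b := (1 : ℂ)) fun k h => by
        have := congrArg Complex.re h
        simp only [Complex.natCast_re, Complex.neg_re, Complex.one_re] at this
        have : (0 : ℝ) ≤ k := k.cast_nonneg
        linarith
    have h := (Complex.one_add_cpow_hasFPowerSeriesOnBall_zero (a := -a)).hasSum (y := -z)
      (by simpa [Metric.mem_eball, edist_zero_right, enorm_eq_nnnorm, ← NNReal.coe_lt_coe]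
        using hz')
    rw [hs, neg_neg] at h
    have h2 := hasSum_ordinaryHypergeometric a 1 1 (z := z) (by simpa using hz')
    have h3 := h.unique (a₂ := ordinaryHypergeometric a 1 1 z) (by
      convert! h2 using 1
      funext k
      change (ordinaryHypergeometricSeries ℂ a 1 1 k) (fun _ => -(-z)) = _
      rw [neg_neg, ordinaryHypergeometricSeries_apply_eq, smul_eq_mul])
    simpa [sub_eq_add_neg] using h3

theorem ne_neg_natCast_of_re_pos {s : ℂ} (hs : 0 < s.re) (k : ℕ) : s ≠ -k := by
  rintro rfl
  simp only [Complex.neg_re, Complex.natCast_re] at hs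
  have : (0 : ℝ) ≤ k := k.cast_nonneg
  linarith

theorem ascPochhammer_eval_ne_zero {s : ℂ} (hs : 0 < s.re) (k : ℕ) :
    (ascPochhammer ℂ k).eval s ≠ 0 := by
  rw [Ne, ascPochhammer_eval_eq_zero_iff]
  rintro ⟨j, -, hj⟩
  exact ne_neg_natCast_of_re_pos hs j (by rw [hj, neg_neg])

theorem Gamma_add_natCast {s : ℂ} (hs : 0 < s.re) (k : ℕ) :
    Complex.Gamma (s + k) = (ascPochhammer ℂ k).eval s * Complex.Gamma s := by
  rw [← Complex.Gamma_add_nat_div_Gamma_eq s (ne_neg_natCast_of_re_pos hs),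
    div_mul_cancel₀ _ (Complex.Gamma_ne_zero_of_re_pos hs)]

/-- Moments of the Beta density, from B(u, v) = Γ(u)Γ(v)/Γ(u+v) and Γ(s+k) = (s)_k Γ(s). -/
theorem ascPochhammer_mul_betaIntegral {u v : ℂ} (hu : 0 < u.re) (hv : 0 < v.re) (k : ℕ) :
    (ascPochhammer ℂ k).eval (u + v) * Complex.betaIntegral (u + k) v =
      (ascPochhammer ℂ k).eval u * Complex.betaIntegral u v := by
  have huv : 0 < (u + v).re := by simpa using add_pos hu hv
  have huk : 0 < (u + k).re := by simpa using add_pos_of_pos_of_nonneg hu k.cast_nonneg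
  have h0 := Complex.Gamma_mul_Gamma_eq_betaIntegral hu hv
  have h1 := Complex.Gamma_mul_Gamma_eq_betaIntegral huk hv
  rw [add_right_comm, Gamma_add_natCast hu, Gamma_add_natCast huv] at h1
  refine mul_left_cancel₀ (Complex.Gamma_ne_zero_of_re_pos huv) ?_
  linear_combination (ascPochhammer ℂ k).eval u * h0 - h1

theorem betaIntegral_ne_zero {u v : ℂ} (hu : 0 < u.re) (hv : 0 < v.re) :
    Complex.betaIntegral u v ≠ 0 := by
  intro h
  have h0 := Complex.Gamma_mul_Gamma_eq_betaIntegral hu hv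
  rw [h, mul_zero] at h0
  exact mul_ne_zero (Complex.Gamma_ne_zero_of_re_pos hu) (Complex.Gamma_ne_zero_of_re_pos hv) h0

/-- Euler's integral representation. -/
theorem exists_isGaussContinuation_of_re_lt (a : ℂ) {b c : ℂ} (hb : 0 < b.re)
    (hbc : b.re < c.re) : ∃ F, IsGaussContinuation a b c F := by
  have hv : 0 < (c - b).re := by simpa using hbc
  have hw := Complex.betaIntegral_convergent hb hv
  rw [intervalIntegrable_iff_integrableOn_Ioc_of_le zero_le_one] at hw
  refine ⟨_, (isGaussContinuation_one_sub_cpow a).integral hw (r := fun t => t) aemeasurable_id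
    ?_ (betaIntegral_ne_zero hb hv) fun k => ?_⟩
  · filter_upwards [ae_restrict_mem measurableSet_Ioc] with t ht using ⟨ht.1.le, ht.2⟩
  · have hk : ∫ t : ℝ in Ioc 0 1, (t : ℂ) ^ (b - 1) * (1 - (t : ℂ)) ^ (c - b - 1) * (t : ℂ) ^ k =
        Complex.betaIntegral (b + k) (c - b) := by
      rw [Complex.betaIntegral, intervalIntegral.integral_of_le zero_le_one]
      refine setIntegral_congr_fun measurableSet_Ioc fun t ht => ?_
      have ht0 : (t : ℂ) ≠ 0 := Complex.ofReal_ne_zero.2 ht.1.ne'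
      rw [add_sub_right_comm, Complex.cpow_add _ _ ht0, Complex.cpow_natCast]
      ring
    have h := ascPochhammer_mul_betaIntegral hb hv k
    have hc := ascPochhammer_eval_ne_zero (s := c) (hb.trans hbc) k
    have h1 := ascPochhammer_eval_ne_zero (s := 1) (by simp) k
    rw [add_sub_cancel] at h
    rw [hk, ordinaryHypergeometricCoefficient, ordinaryHypergeometricCoefficient,
      mul_inv_cancel_right₀ h1]
    field_simp
    linear_combination (-(ascPochhammer ℂ k).eval a * (k.factorial : ℂ)⁻¹) * h

theorem hasSum_mul_deriv_ordinaryHypergeometric (a b c : ℂ) {z : ℂ} (hz : ‖z‖ < 1) :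
    HasSum (fun k : ℕ => (k : ℂ) * (ordinaryHypergeometricCoefficient a b c k * z ^ k))
      (z * deriv (ordinaryHypergeometric a b c) z) := by
  obtain ⟨ρ, hρ, hρ1⟩ := exists_between hz
  have hρ0 : 0 ≤ ρ := (norm_nonneg z).trans hρ.le
  have hu := summable_norm_ordinaryHypergeometric a b c (z := (ρ : ℂ))
    (by rwa [Complex.norm_real, Real.norm_of_nonneg hρ0])
  have h := Complex.hasSum_deriv_of_summable_norm
    (F := fun k w => ordinaryHypergeometricCoefficient a b c k * w ^ k)
    (U := Metric.ball 0 ρ) hu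
    (fun i => by fun_prop) Metric.isOpen_ball (fun i w hw => by
      have hw' : ‖w‖ < ρ := by simpa using hw
      rw [norm_mul _ (w ^ i), norm_mul _ ((ρ : ℂ) ^ i), norm_pow, norm_pow, Complex.norm_real,
        Real.norm_of_nonneg hρ0]
      gcongr) (z := z) (by simpa using hρ)
  have he : (fun w => ∑' k, ordinaryHypergeometricCoefficient a b c k * w ^ k) =
      (ordinaryHypergeometric a b c : ℂ → ℂ) := by
    rw [ordinaryHypergeometric_eq_tsum]; rfl
  rw [he] at h
  convert! h.mul_left z using 1
  funext k
  simp only [deriv_const_mul_field', differentiableAt_fun_id, deriv_fun_pow, deriv_id'', mul_one]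
  rcases k with _ | k
  · simp
  · simp only [Nat.add_sub_cancel, pow_succ]; ring

theorem ordinaryHypergeometricCoefficient_lower (a b : ℂ) {c : ℂ} (hc : 0 < c.re) (k : ℕ) :
    ordinaryHypergeometricCoefficient a b (c + 1) k * (c + k) =
      c * ordinaryHypergeometricCoefficient a b c k := by
  have h1 := ascPochhammer_succ_eval k c
  have h2 : (ascPochhammer ℂ (k + 1)).eval c = c * (ascPochhammer ℂ k).eval (c + 1) := by
    rw [ascPochhammer_succ_left]; simp
  have h3 := ascPochhammer_eval_ne_zero hc k
  have h4 := ascPochhammer_eval_ne_zero (s := c + 1) (by simp; linarith) k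
  have h5 : (k.factorial : ℂ) ≠ 0 := by exact_mod_cast k.factorial_ne_zero
  simp only [ordinaryHypergeometricCoefficient]
  field_simp
  linear_combination (ascPochhammer ℂ k).eval a * (ascPochhammer ℂ k).eval b * (h2 - h1)

/-- The operator z d/dz multiplies the k-th term by k, and (c+k)/(c+1)_k = c/(c)_k. Thus c + z d/dz
lowers the third parameter without leaving the cut plane. -/
theorem IsGaussContinuation.lower {a b c : ℂ} (hc : 0 < c.re) {F : ℂ → ℂ}
    (hF : IsGaussContinuation a b (c + 1) F) :
    IsGaussContinuation a b c fun z => c⁻¹ * (c * F z + z * deriv F z) := by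
  have hc0 : c ≠ 0 := by rintro rfl; simp at hc
  refine ⟨?_, fun z hz => ?_⟩
  · exact ((hF.1.const_mul c).add (differentiableOn_id.mul
      (hF.1.deriv cutPlane_isOpen))).const_mul _
  · have hz' : ‖z‖ < 1 := by simpa using hz
    have hd : deriv F z = deriv (ordinaryHypergeometric a b (c + 1)) z :=
      EventuallyEq.deriv_eq (eventually_of_mem (Metric.isOpen_ball.mem_nhds hz) hF.2)
    have h := ((hasSum_ordinaryHypergeometric a b (c + 1) hz').mul_left c).add
      (hasSum_mul_deriv_ordinaryHypergeometric a b (c + 1) hz')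
    simp only
    rw [hd, hF.2 z hz, inv_mul_eq_iff_eq_mul₀ hc0]
    refine h.unique ?_
    convert! (hasSum_ordinaryHypergeometric a b c hz').mul_left c using 1
    funext k
    linear_combination z ^ k * ordinaryHypergeometricCoefficient_lower a b hc k

theorem exists_isGaussContinuation (a : ℂ) {b c : ℂ} (hb : 0 < b.re) (hc : 0 < c.re) :
    ∃ F, IsGaussContinuation a b c F := by
  -- Euler's integral needs Re b < Re c: it is used at c + N, followed by N lowerings.
  obtain ⟨N, hN⟩ := exists_nat_gt (b.re - c.re)
  replace hN : b.re < c.re + N := by linarith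
  induction N generalizing c with
  | zero => exact exists_isGaussContinuation_of_re_lt a hb (by simpa using hN)
  | succ N ih =>
    obtain ⟨F, hF⟩ := ih (c := c + 1) (by simp; linarith) (by
      push_cast at hN
      simp only [Complex.add_re, Complex.one_re]
      linarith)
    exact ⟨_, hF.lower hc⟩

/-! ### The Fourier transform of powers of sech -/

/-- The substitution t = e^v / (2 cosh v), with 1 - t = e^(-v) / (2 cosh v), carries the Beta
integral over (0, 1) to the real line. -/
theorem image_sigmoid_two_mul : (fun v : ℝ => Real.sigmoid (2 * v)) '' univ = Ioo 0 1 := by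
  rw [← Real.range_sigmoid, image_univ]
  exact (mul_left_surjective₀ (two_ne_zero' ℝ)).range_comp Real.sigmoid

theorem hasDerivAt_sigmoid_two_mul (v : ℝ) :
    HasDerivAt (fun v : ℝ => Real.sigmoid (2 * v))
      (2 * (Real.sigmoid (2 * v) * Real.sigmoid (-(2 * v)))) v := by
  have h := (Real.hasDerivAt_sigmoid (2 * v)).comp v ((hasDerivAt_id v).const_mul 2)
  rw [Real.sigmoid_neg]
  convert! h using 1
  ring

theorem log_sigmoid_two_mul (v : ℝ) :
    Real.log (Real.sigmoid (2 * v)) = v - Real.log (2 * Real.cosh v) := by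
  have h : Real.sigmoid (2 * v) = Real.exp v / (2 * Real.cosh v) := by
    have := Real.cosh_pos v
    rw [Real.sigmoid_def, Real.cosh_eq, neg_mul_eq_mul_neg, two_mul, Real.exp_add]
    have := Real.exp_pos v
    have h2 : Real.exp v * Real.exp (-v) = 1 := by rw [← Real.exp_add]; simp
    have := Real.exp_pos (-v)
    field_simp
    linear_combination (-Real.exp (-v)) * h2
  rw [h, Real.log_div (Real.exp_pos v).ne' (by have := Real.cosh_pos v; positivity), Real.log_exp]

theorem sigmoid_cpow_mul_sigmoid_cpow (s y v : ℝ) :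
    (Real.sigmoid (2 * v) : ℂ) ^ ((s : ℂ) + Complex.I * y) *
        (Real.sigmoid (-(2 * v)) : ℂ) ^ ((s : ℂ) - Complex.I * y) =
      ((2 : ℝ) ^ (-2 * s) : ℝ) * (Complex.exp (2 * y * v * Complex.I) *
        ((Real.cosh v ^ (-2 * s) : ℝ) : ℂ)) := by
  have h1 : (Real.sigmoid (2 * v) : ℂ) ≠ 0 := Complex.ofReal_ne_zero.2 (Real.sigmoid_pos _).ne'
  have h2 : (Real.sigmoid (-(2 * v)) : ℂ) ≠ 0 := Complex.ofReal_ne_zero.2 (Real.sigmoid_pos _).ne'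
  have hc := Real.cosh_pos v
  rw [Complex.cpow_def_of_ne_zero h1, Complex.cpow_def_of_ne_zero h2,
    ← Complex.ofReal_log (Real.sigmoid_nonneg _), ← Complex.ofReal_log (Real.sigmoid_nonneg _),
    log_sigmoid_two_mul, neg_mul_eq_mul_neg, log_sigmoid_two_mul, Real.cosh_neg,
    Real.log_mul two_ne_zero hc.ne', Real.rpow_def_of_pos two_pos, Real.rpow_def_of_pos hc,
    ← Complex.exp_add, Complex.ofReal_exp, Complex.ofReal_exp, ← Complex.exp_add,
    ← Complex.exp_add]
  congr 1
  push_cast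
  ring

/-- The Jacobian 2t(1-t) absorbs both exponents -1 and leaves the extra factor 2. -/
theorem sigmoid_beta_integrand (s y v : ℝ) :
    |2 * (Real.sigmoid (2 * v) * Real.sigmoid (-(2 * v)))| •
      ((Real.sigmoid (2 * v) : ℂ) ^ ((s : ℂ) + Complex.I * y - 1) *
        (1 - (Real.sigmoid (2 * v) : ℂ)) ^ ((s : ℂ) - Complex.I * y - 1)) =
      ((2 : ℝ) ^ (1 - 2 * s) : ℝ) * (Complex.exp (2 * y * v * Complex.I) *
        ((Real.cosh v ^ (-2 * s) : ℝ) : ℂ)) := by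
  have h1 := Real.sigmoid_pos (2 * v)
  have h2 := Real.sigmoid_pos (-(2 * v))
  have h1' : (Real.sigmoid (2 * v) : ℂ) ≠ 0 := Complex.ofReal_ne_zero.2 h1.ne'
  have h2' : (Real.sigmoid (-(2 * v)) : ℂ) ≠ 0 := Complex.ofReal_ne_zero.2 h2.ne'
  have h3 : (2 : ℝ) ^ (1 - 2 * s) = 2 * 2 ^ (-2 * s) := by
    rw [sub_eq_add_neg, Real.rpow_add two_pos, Real.rpow_one, neg_mul]
  have h4 : 1 - (Real.sigmoid (2 * v) : ℂ) = Real.sigmoid (-(2 * v)) := by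
    rw [Real.sigmoid_neg]; push_cast; rfl
  rw [abs_of_pos (by positivity), h4, h3, Complex.ofReal_mul, mul_assoc,
    ← sigmoid_cpow_mul_sigmoid_cpow, Complex.cpow_sub _ _ h1', Complex.cpow_sub _ _ h2',
    Complex.cpow_one, Complex.cpow_one, Complex.real_smul]
  push_cast
  field_simp

theorem integrable_exp_mul_cosh_rpow {s : ℝ} (hs : 0 < s) (y : ℝ) :
    Integrable fun v : ℝ =>
      Complex.exp (2 * y * v * Complex.I) * ((Real.cosh v ^ (-2 * s) : ℝ) : ℂ) := by
  have h := Complex.betaIntegral_convergent (u := (s : ℂ) + Complex.I * y)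
    (v := (s : ℂ) - Complex.I * y) (by simpa using hs) (by simpa using hs)
  rw [intervalIntegrable_iff_integrableOn_Ioo_of_le zero_le_one, ← image_sigmoid_two_mul,
    integrableOn_image_iff_integrableOn_abs_deriv_smul MeasurableSet.univ
      (fun v _ => (hasDerivAt_sigmoid_two_mul v).hasDerivWithinAt)
      (fun a _ b _ hab => by simpa using Real.sigmoid_injective hab), integrableOn_univ] at h
  simp_rw [sigmoid_beta_integrand] at h
  refine (integrable_const_mul_iff (IsUnit.mk0 _ ?_) _).1 h
  exact Complex.ofReal_ne_zero.2 (Real.rpow_pos_of_pos two_pos _).ne'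

/-- The Fourier transform of a power of the hyperbolic secant. -/
theorem betaIntegral_eq_integral_cosh {s : ℝ} (y : ℝ) :
    Complex.betaIntegral ((s : ℂ) + Complex.I * y) ((s : ℂ) - Complex.I * y) =
      ((2 : ℝ) ^ (1 - 2 * s) : ℝ) * ∫ v : ℝ,
        Complex.exp (2 * y * v * Complex.I) * ((Real.cosh v ^ (-2 * s) : ℝ) : ℂ) := by
  rw [Complex.betaIntegral, intervalIntegral.integral_of_le zero_le_one, integral_Ioc_eq_integral_Ioo,
    ← image_sigmoid_two_mul, integral_image_eq_integral_abs_deriv_smul MeasurableSet.univ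
      (fun v _ => (hasDerivAt_sigmoid_two_mul v).hasDerivWithinAt)
      (fun a _ b _ hab => by simpa using Real.sigmoid_injective hab), setIntegral_univ]
  simp_rw [sigmoid_beta_integrand]
  rw [integral_const_mul]

/-! ### The Fourier representation -/

theorem ascPochhammer_eval_two_mul (s : ℂ) (k : ℕ) :
    (ascPochhammer ℂ (2 * k)).eval (2 * s) =
      4 ^ k * (ascPochhammer ℂ k).eval s * (ascPochhammer ℂ k).eval (s + 1 / 2) := by
  induction k with
  | zero => simp
  | succ k ih =>
    rw [show 2 * (k + 1) = 2 * k + 1 + 1 by ring]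
    simp only [ascPochhammer_succ_eval, ih]
    push_cast
    ring

/-- The moment condition of `IsGaussContinuation.integral`: the factor cosh^(-2k) merely shifts μ to
μ + k, so both integrals are Beta values, compared through Γ and the duplication formula. -/
theorem ordinaryHypergeometricCoefficient_mul_integral_cosh {μ : ℝ} (hμ : 0 < μ) (c : ℂ) (y : ℝ)
    (k : ℕ) :
    ordinaryHypergeometricCoefficient ((μ : ℂ) + Complex.I * y) ((μ : ℂ) - Complex.I * y) c k *
        ∫ v : ℝ, Complex.exp (2 * y * v * Complex.I) * ((Real.cosh v ^ (-2 * μ) : ℝ) : ℂ) =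
      ordinaryHypergeometricCoefficient (μ : ℂ) ((μ : ℂ) + 1 / 2) c k *
        ∫ v : ℝ, Complex.exp (2 * y * v * Complex.I) * ((Real.cosh v ^ (-2 * μ) : ℝ) : ℂ) *
          ((1 / Real.cosh v ^ 2 : ℝ) : ℂ) ^ k := by
  have hμk : 0 < μ + k := by positivity
  have hint : ∫ v : ℝ, Complex.exp (2 * y * v * Complex.I) *
      ((Real.cosh v ^ (-2 * μ) : ℝ) : ℂ) * ((1 / Real.cosh v ^ 2 : ℝ) : ℂ) ^ k =
      ∫ v : ℝ, Complex.exp (2 * y * v * Complex.I) *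
        ((Real.cosh v ^ (-2 * (μ + k)) : ℝ) : ℂ) := by
    refine integral_congr_ae (ae_of_all _ fun v => ?_)
    have hc := Real.cosh_pos v
    have : Real.cosh v ^ (-2 * (μ + k)) = Real.cosh v ^ (-2 * μ) * (1 / Real.cosh v ^ 2) ^ k := by
      rw [mul_add, Real.rpow_add hc, one_div, inv_pow, ← pow_mul, neg_mul 2 (k : ℝ),
        Real.rpow_neg hc.le, ← Real.rpow_natCast]
      push_cast
      rfl
    simp only
    rw [this]
    push_cast
    ring
  have hp : 0 < ((μ : ℂ) + Complex.I * y).re := by simpa using hμ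
  have hq : 0 < ((μ : ℂ) - Complex.I * y).re := by simpa using hμ
  have hpk : 0 < (((μ + k : ℝ) : ℂ) + Complex.I * y).re := by simpa using hμk
  have hqk : 0 < (((μ + k : ℝ) : ℂ) - Complex.I * y).re := by simpa using hμk
  have h2μ : 0 < (2 * (μ : ℂ)).re := by simpa using hμ
  have h0 := Complex.Gamma_mul_Gamma_eq_betaIntegral hp hq
  have h1 := Complex.Gamma_mul_Gamma_eq_betaIntegral hpk hqk
  rw [betaIntegral_eq_integral_cosh] at h0 h1
  rw [show ((μ + k : ℝ) : ℂ) + Complex.I * y = (μ : ℂ) + Complex.I * y + k by push_cast; ring,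
    show ((μ + k : ℝ) : ℂ) - Complex.I * y = (μ : ℂ) - Complex.I * y + k by push_cast; ring,
    show (μ : ℂ) + Complex.I * y + k + ((μ : ℂ) - Complex.I * y + k) =
      2 * (μ : ℂ) + ((2 * k : ℕ) : ℂ) by push_cast; ring,
    Gamma_add_natCast hp, Gamma_add_natCast hq, Gamma_add_natCast h2μ,
    ascPochhammer_eval_two_mul] at h1
  rw [show (μ : ℂ) + Complex.I * y + ((μ : ℂ) - Complex.I * y) = 2 * (μ : ℂ) by ring] at h0
  -- This 4^(-k) cancels the 4^k of the duplication formula.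
  have hpow : (2 : ℝ) ^ (1 - 2 * (μ + k)) = 2 ^ (1 - 2 * μ) * (4 ^ k)⁻¹ := by
    rw [show 1 - 2 * (μ + k) = 1 - 2 * μ + -((2 * k : ℕ) : ℝ) by push_cast; ring,
      Real.rpow_add two_pos, Real.rpow_neg two_pos.le, Real.rpow_natCast, pow_mul]
    norm_num
  rw [hpow] at h1
  push_cast at h1
  rw [hint]
  have hG := Complex.Gamma_ne_zero_of_re_pos h2μ
  have hr : (((2 : ℝ) ^ (1 - 2 * μ) : ℝ) : ℂ) ≠ 0 :=
    Complex.ofReal_ne_zero.2 (Real.rpow_pos_of_pos two_pos _).ne'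
  have h4 : (4 : ℂ) ^ k ≠ 0 := pow_ne_zero _ (by norm_num)
  generalize (∫ v : ℝ, Complex.exp (2 * y * v * Complex.I) *
        ((Real.cosh v ^ (-2 * (μ + k)) : ℝ) : ℂ)) = Jk at *
  generalize (∫ v : ℝ, Complex.exp (2 * y * v * Complex.I) *
        ((Real.cosh v ^ (-2 * μ) : ℝ) : ℂ)) = J at *
  have key : (ascPochhammer ℂ k).eval ((μ : ℂ) + Complex.I * y) *
      (ascPochhammer ℂ k).eval ((μ : ℂ) - Complex.I * y) * J =
      (ascPochhammer ℂ k).eval (μ : ℂ) * (ascPochhammer ℂ k).eval ((μ : ℂ) + 1 / 2) * Jk := by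
    refine mul_left_cancel₀ (mul_ne_zero hG hr) ?_
    linear_combination h1 - (ascPochhammer ℂ k).eval ((μ : ℂ) + Complex.I * y) *
      (ascPochhammer ℂ k).eval ((μ : ℂ) - Complex.I * y) * h0 + (Complex.Gamma (2 * μ) *
      ((2 : ℝ) ^ (1 - 2 * μ) : ℝ) * (ascPochhammer ℂ k).eval (μ : ℂ) *
      (ascPochhammer ℂ k).eval ((μ : ℂ) + 1 / 2) * Jk) * mul_inv_cancel₀ h4
  simp only [ordinaryHypergeometricCoefficient]
  linear_combination ((k.factorial : ℂ)⁻¹ * ((ascPochhammer ℂ k).eval c)⁻¹) * key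

theorem isGaussContinuation_gauss2F1 (a : ℂ) {b c : ℂ} (hb : 0 < b.re) (hc : 0 < c.re) :
    IsGaussContinuation a b c (gauss2F1 a b c) :=
  Classical.epsilon_spec (exists_isGaussContinuation a hb hc)

theorem ofReal_norm_Gamma_sq (μ y : ℝ) :
    ((‖Complex.Gamma ((μ : ℂ) + Complex.I * y)‖ ^ 2 : ℝ) : ℂ) =
      Complex.Gamma ((μ : ℂ) + Complex.I * y) * Complex.Gamma ((μ : ℂ) - Complex.I * y) := by
  have h : (μ : ℂ) - Complex.I * y = (starRingEnd ℂ) ((μ : ℂ) + Complex.I * y) := by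
    simp [sub_eq_add_neg]
  rw [h, Complex.Gamma_conj, Complex.mul_conj, Complex.normSq_eq_norm_sq]

/-- The Fourier representation of `|Γ(μ + iy)|² ₂F₁(μ + iy, μ - iy; c; z)`. -/
theorem norm_Gamma_sq_mul_gauss2F1 {μ : ℝ} (hμ : 0 < μ) {c : ℂ} (hc : 0 < c.re) (y : ℝ) {z : ℂ}
    (hz : z ∈ cutPlane) :
    ((‖Complex.Gamma ((μ : ℂ) + Complex.I * y)‖ ^ 2 : ℝ) : ℂ) *
        gauss2F1 ((μ : ℂ) + Complex.I * y) ((μ : ℂ) - Complex.I * y) c z =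
      ((2 ^ (1 - 2 * μ) * Real.Gamma (2 * μ) : ℝ) : ℂ) *
        ∫ v : ℝ, Complex.exp (2 * y * v * Complex.I) * ((Real.cosh v ^ (-2 * μ) : ℝ) : ℂ) *
          gauss2F1 (μ : ℂ) ((μ : ℂ) + 1 / 2) c (((1 / Real.cosh v ^ 2 : ℝ) : ℂ) * z) := by
  have hp : 0 < ((μ : ℂ) + Complex.I * y).re := by simpa using hμ
  have hq : 0 < ((μ : ℂ) - Complex.I * y).re := by simpa using hμ
  have h0 := Complex.Gamma_mul_Gamma_eq_betaIntegral hp hq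
  have hB := betaIntegral_ne_zero hp hq
  rw [betaIntegral_eq_integral_cosh] at h0 hB
  have hM := right_ne_zero_of_mul hB
  have hmeas : Measurable fun v : ℝ => 1 / Real.cosh v ^ 2 := by fun_prop
  have hr : ∀ v : ℝ, 1 / Real.cosh v ^ 2 ∈ Icc (0 : ℝ) 1 := fun v =>
    ⟨by positivity, by
      rw [div_le_one (pow_pos (Real.cosh_pos v) 2)]
      exact one_le_pow₀ (Real.one_le_cosh v)⟩
  have hF := (isGaussContinuation_gauss2F1 (μ : ℂ) (b := (μ : ℂ) + 1 / 2) (c := c)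
    (by simp; linarith) hc).integral (integrable_exp_mul_cosh_rpow hμ y) hmeas.aemeasurable
    (ae_of_all _ hr) hM (ordinaryHypergeometricCoefficient_mul_integral_cosh hμ c y)
  rw [gauss2F1_eq hF hz, ofReal_norm_Gamma_sq, h0,
    show (μ : ℂ) + Complex.I * y + ((μ : ℂ) - Complex.I * y) = ((2 * μ : ℝ) : ℂ) by push_cast; ring,
    Complex.Gamma_ofReal]
  rw [Complex.ofReal_mul]
  generalize (∫ v : ℝ, Complex.exp (2 * y * v * Complex.I) * ((Real.cosh v ^ (-2 * μ) : ℝ) : ℂ) *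
    gauss2F1 (μ : ℂ) ((μ : ℂ) + 1 / 2) c (((1 / Real.cosh v ^ 2 : ℝ) : ℂ) * z)) = J
  linear_combination (Real.Gamma (2 * μ) * ((2 : ℝ) ^ (1 - 2 * μ) : ℝ) * J) * mul_inv_cancel₀ hM

/-! ### Poisson summation in a strip -/

theorem isOpen_abs_im_lt (δ : ℝ) : IsOpen {w : ℂ | |w.im| < δ} :=
  isOpen_lt (by fun_prop) continuous_const

/-- Cauchy's estimate on circles of radius δ/2; moving Re w by at most δ/2 costs the factor
e^(κδ/2). -/
theorem norm_deriv_le_of_strip {f : ℂ → ℂ} {δ C κ : ℝ} (hδ : 0 < δ) (hκ : 0 < κ)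
    (hf : DifferentiableOn ℂ f {w | |w.im| < δ})
    (hb : ∀ w : ℂ, |w.im| < δ → ‖f w‖ ≤ C * Real.exp (-κ * |w.re|)) {w : ℂ}
    (hw : |w.im| < δ / 2) :
    ‖deriv f w‖ ≤ C * Real.exp (κ * (δ / 2)) / (δ / 2) * Real.exp (-κ * |w.re|) := by
  have hC : 0 ≤ C := by
    have h := (norm_nonneg _).trans (hb 0 (by simpa using hδ))
    simpa using h
  have hsub : Metric.closedBall w (δ / 2) ⊆ {w | |w.im| < δ} := fun z hz => by
    have h1 : |(z - w).im| ≤ δ / 2 :=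
      (Complex.abs_im_le_norm _).trans (by simpa [dist_eq_norm] using hz)
    have h2 : |z.im| ≤ |(z - w).im| + |w.im| := by
      simpa using abs_add_le (z - w).im w.im
    simp only [mem_ofPred_eq]
    linarith
  have h := Complex.norm_deriv_le_of_forall_mem_sphere_norm_le (c := w)
    (C := C * Real.exp (κ * (δ / 2)) * Real.exp (-κ * |w.re|)) (half_pos hδ)
    (hf.diffContOnCl_ball hsub) fun z hz => by
      refine (hb z (hsub (Metric.sphere_subset_closedBall hz))).trans ?_
      rw [mul_assoc, ← Real.exp_add]
      have h1 : |(z - w).re| ≤ δ / 2 :=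
        (Complex.abs_re_le_norm _).trans (by simpa [dist_eq_norm] using hz.le)
      have h2 : |w.re| ≤ |z.re| + |(z - w).re| := by
        have := abs_sub_abs_le_abs_sub w.re z.re
        rw [abs_sub_comm, ← Complex.sub_re] at this
        linarith
      gcongr
      nlinarith
  refine h.trans_eq ?_
  ring

theorem exp_neg_mul_abs_le {κ : ℝ} (hκ : 0 < κ) :
    ∃ K : ℝ, 0 ≤ K ∧ ∀ t : ℝ, Real.exp (-κ * |t|) ≤ K * (1 + t ^ 2)⁻¹ := by
  refine ⟨1 + 2 / κ ^ 2, by positivity, fun t => ?_⟩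
  have h := Real.quadratic_le_exp_of_nonneg (x := κ * |t|) (by positivity)
  rw [neg_mul, Real.exp_neg, ← div_eq_mul_inv, le_div_iff₀ (by positivity),
    inv_mul_le_iff₀ (Real.exp_pos _)]
  have h1 : 0 ≤ κ * |t| := by positivity
  have h2 : 1 + κ ^ 2 * t ^ 2 / 2 ≤ Real.exp (κ * |t|) := by
    rw [mul_pow, sq_abs] at h; linarith
  refine le_trans ?_ (mul_le_mul_of_nonneg_right h2 (by positivity))
  have h3 : (1 + κ ^ 2 * t ^ 2 / 2) * (1 + 2 / κ ^ 2) =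
      1 + t ^ 2 + 2 / κ ^ 2 + κ ^ 2 * t ^ 2 / 2 := by field_simp; ring
  rw [h3]
  have : 0 ≤ 2 / κ ^ 2 + κ ^ 2 * t ^ 2 / 2 := by positivity
  linarith

theorem integrable_of_strip {f : ℂ → ℂ} {δ C κ : ℝ} (hδ : 0 < δ) (hκ : 0 < κ)
    (hf : DifferentiableOn ℂ f {w | |w.im| < δ})
    (hb : ∀ w : ℂ, |w.im| < δ → ‖f w‖ ≤ C * Real.exp (-κ * |w.re|)) :
    Continuous (fun t : ℝ => f t) ∧ Integrable (fun t : ℝ => f t) := by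
  have hc : Continuous (fun t : ℝ => f t) :=
    hf.continuousOn.comp_continuous Complex.continuous_ofReal (by simpa using hδ)
  obtain ⟨K, hK, hKe⟩ := exp_neg_mul_abs_le hκ
  have hC : 0 ≤ C := by
    have h := (norm_nonneg _).trans (hb 0 (by simpa using hδ))
    simpa using h
  refine ⟨hc, (integrable_inv_one_add_sq.const_mul (C * K)).mono' hc.aestronglyMeasurable
    (ae_of_all _ fun t => ?_)⟩
  refine (hb t (by simpa using hδ)).trans ?_
  rw [Complex.ofReal_re, mul_assoc]
  exact mul_le_mul_of_nonneg_left (hKe t) hC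

open FourierTransform in
/-- Poisson summation for functions which are holomorphic and exponentially small in a strip. -/
theorem poisson_summation_of_strip {f : ℂ → ℂ} {δ C κ : ℝ} (hδ : 0 < δ) (hκ : 0 < κ)
    (hf : DifferentiableOn ℂ f {w | |w.im| < δ})
    (hb : ∀ w : ℂ, |w.im| < δ → ‖f w‖ ≤ C * Real.exp (-κ * |w.re|)) :
    Summable (fun n : ℤ => f ((n : ℝ) : ℂ)) ∧
      Summable (fun n : ℤ => 𝓕 (fun t : ℝ => f t) (n : ℝ)) ∧
      ∑' n : ℤ, f ((n : ℝ) : ℂ) = ∑' n : ℤ, 𝓕 (fun t : ℝ => f t) (n : ℝ) := by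
  have hsub : ∀ {δ : ℝ}, 0 < δ → {w : ℂ | |w.im| < δ / 2} ⊆ {w | |w.im| < δ} := fun h w hw => by
    simp only [mem_ofPred_eq] at hw ⊢; linarith
  -- Each derivative halves the strip and keeps the decay rate; two derivatives make the Fourier
  -- transform O(n⁻²).
  have hd1 := (hf.deriv (isOpen_abs_im_lt δ)).mono (hsub hδ)
  have hb1 := fun w hw => norm_deriv_le_of_strip (w := w) hδ hκ hf hb hw
  have hd2 := (hd1.deriv (isOpen_abs_im_lt (δ / 2))).mono (hsub (half_pos hδ))
  have hb2 := fun w hw => norm_deriv_le_of_strip (w := w) (half_pos hδ) hκ hd1 hb1 hw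
  obtain ⟨hc0, hi0⟩ := integrable_of_strip hδ hκ hf hb
  obtain ⟨-, hi1⟩ := integrable_of_strip (half_pos hδ) hκ hd1 hb1
  obtain ⟨-, hi2⟩ := integrable_of_strip (half_pos (half_pos hδ)) hκ hd2 hb2
  have hder : ∀ {g : ℂ → ℂ} {δ : ℝ}, 0 < δ → DifferentiableOn ℂ g {w | |w.im| < δ} →
      ∀ t : ℝ, HasDerivAt (fun t : ℝ => g t) (deriv g t) t := fun {g δ} hδ hg t =>
    (hg.differentiableAt ((isOpen_abs_im_lt δ).mem_nhds (by simpa using hδ))).hasDerivAt.comp_ofReal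
  have e1 : deriv (fun t : ℝ => f t) = fun t : ℝ => deriv f t :=
    funext fun t => (hder hδ hf t).deriv
  have e2 : deriv (fun t : ℝ => deriv f t) = fun t : ℝ => deriv (deriv f) t :=
    funext fun t => (hder (half_pos hδ) hd1 t).deriv
  have F1 := Real.fourier_deriv hi0 (fun t => (hder hδ hf t).differentiableAt) (by rwa [e1])
  have F2 := Real.fourier_deriv hi1
    (fun t => (hder (half_pos hδ) hd1 t).differentiableAt) (by rwa [e2])
  rw [e1] at F1
  rw [e2, F1] at F2
  have hF : Summable (fun n : ℤ => 𝓕 (fun t : ℝ => f t) (n : ℝ)) := by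
    set A := ∫ t : ℝ, ‖deriv (deriv f) (t : ℂ)‖
    have hA : ∀ ξ : ℝ, ‖𝓕 (fun t : ℝ => deriv (deriv f) (t : ℂ)) ξ‖ ≤ A := fun ξ =>
      VectorFourier.norm_fourierIntegral_le_integral_norm _ _ _ _ _
    refine Summable.of_norm_bounded_eventually
      ((Real.summable_one_div_int_pow.2 one_lt_two).mul_left (A / (2 * Real.pi) ^ 2)) ?_
    -- The bound by A / (2πn)² requires n ≠ 0.
    filter_upwards [(finite_singleton (0 : ℤ)).compl_mem_cofinite] with n hn
    have hn0 : (n : ℝ) ≠ 0 := Int.cast_ne_zero.2 hn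
    have h := hA n
    rw [F2] at h
    simp only [smul_eq_mul, norm_mul, Complex.norm_I, Complex.norm_real, Complex.norm_ofNat,
      Real.norm_of_nonneg Real.pi_pos.le, mul_one] at h
    have hp : 0 < (2 * Real.pi) ^ 2 * (n : ℝ) ^ 2 := by positivity
    rw [div_mul_div_comm, mul_one, le_div_iff₀ hp]
    refine le_trans (le_of_eq ?_) h
    rw [← sq_abs (n : ℝ), Real.norm_eq_abs]
    ring
  have hO : (fun t : ℝ => f t) =O[cocompact ℝ] fun t : ℝ => |t| ^ (-2 : ℝ) := by
    obtain ⟨K, hK, hKe⟩ := exp_neg_mul_abs_le hκ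
    have hC : 0 ≤ C := by
      have h := (norm_nonneg _).trans (hb 0 (by simpa using hδ))
      simpa using h
    refine Asymptotics.IsBigO.of_bound (C * K) ?_
    filter_upwards [(isCompact_singleton (x := (0 : ℝ))).compl_mem_cocompact] with t ht
    refine (hb t (by simpa using hδ)).trans ?_
    rw [Complex.ofReal_re, mul_assoc]
    refine mul_le_mul_of_nonneg_left ((hKe t).trans ?_) hC
    have ht0 : 0 < |t| := abs_pos.2 ht
    rw [Real.norm_of_nonneg (by positivity), Real.rpow_neg ht0.le, Real.rpow_two, sq_abs]
    gcongr
    · exact sq_pos_of_ne_zero ht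
    · linarith
  refine ⟨?_, hF, ?_⟩
  · exact summable_of_isBigO (Real.summable_abs_int_rpow one_lt_two)
      (hO.comp_tendsto Int.tendsto_coe_cofinite)
  · simpa using Real.tsum_eq_tsum_fourier_of_rpow_decay_of_summable hc0 one_lt_two hO hF 0

/-! ### Holomorphy and decay of the sech profile -/

/-- Here cos(Im w) > 1/2 ≥ |sin(Im w)| and |sinh| ≤ cosh on the reals. So cosh w lies in the sector
|arg| < π/4: its principal powers are holomorphic and its square has positive real part. -/
theorem cosh_strip {w : ℂ} (hw : |w.im| < 1 / 2) :
    1 / 2 * Real.cosh w.re ≤ (Complex.cosh w).re ∧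
      |(Complex.cosh w).im| < (Complex.cosh w).re := by
  have hre : (Complex.cosh w).re = Real.cosh w.re * Real.cos w.im := by
    conv_lhs => rw [← Complex.re_add_im w, Complex.cosh_add, Complex.cosh_mul_I, Complex.sinh_mul_I]
    simp [Complex.cosh_ofReal_re, Complex.sinh_ofReal_re, Complex.cos_ofReal_re,
      Complex.sin_ofReal_re]
  have him : (Complex.cosh w).im = Real.sinh w.re * Real.sin w.im := by
    conv_lhs => rw [← Complex.re_add_im w, Complex.cosh_add, Complex.cosh_mul_I, Complex.sinh_mul_I]
    simp [Complex.cosh_ofReal_re, Complex.sinh_ofReal_re, Complex.cos_ofReal_re,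
      Complex.sin_ofReal_re]
  have h1 := Real.one_sub_sq_div_two_le_cos (x := w.im)
  have h2 : w.im ^ 2 < (1 / 2) ^ 2 := sq_lt_sq' (by linarith [(abs_lt.1 hw).1]) (abs_lt.1 hw).2
  have h3 : 1 / 2 < Real.cos w.im := by linarith
  have h4 : |Real.sin w.im| ≤ 1 / 2 := Real.abs_sin_le_abs.trans hw.le
  have h5 := Real.cosh_pos w.re
  have h6 : |Real.sinh w.re| ≤ Real.cosh w.re := by
    rw [abs_le]
    exact ⟨by linarith [Real.exp_pos w.re, Real.cosh_add_sinh w.re], (Real.sinh_lt_cosh _).le⟩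
  rw [hre, him, abs_mul]
  constructor
  · nlinarith
  · calc |Real.sinh w.re| * |Real.sin w.im| ≤ Real.cosh w.re * (1 / 2) := by gcongr
      _ < _ := by gcongr

theorem half_exp_abs_le_cosh (t : ℝ) : Real.exp |t| / 2 ≤ Real.cosh t := by
  rw [← Real.cosh_abs, Real.cosh_eq]
  linarith [Real.exp_pos (-|t|)]

theorem re_div_cosh_sq_nonneg {w : ℂ} (hw : |w.im| < 1 / 2) :
    0 ≤ (1 / Complex.cosh w ^ 2).re := by
  obtain ⟨-, h⟩ := cosh_strip hw
  rw [one_div, Complex.inv_re]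
  refine div_nonneg ?_ (Complex.normSq_nonneg _)
  have h1 := sq_lt_sq' (by linarith [neg_abs_le (Complex.cosh w).im, abs_nonneg (Complex.cosh w).im]) h
  rw [sq_abs] at h1
  rw [sq, Complex.mul_re]
  nlinarith

/-- The function `cosh(β w)^(-2μ) G(-x² / cosh²(β w))` satisfies the hypotheses of Poisson
summation. -/
theorem sech_profile_strip {G : ℂ → ℂ} (hG : DifferentiableOn ℂ G cutPlane) {μ β : ℝ} (hμ : 0 < μ)
    (hβ : 0 < β) (x : ℝ) :
    DifferentiableOn ℂ (fun w : ℂ => Complex.cosh (β * w) ^ ((-2 * μ : ℝ) : ℂ) *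
        G ((1 / Complex.cosh (β * w) ^ 2) * (-(x : ℂ) ^ 2))) {w | |w.im| < 1 / (2 * β)} ∧
      ∃ C : ℝ, ∀ w : ℂ, |w.im| < 1 / (2 * β) →
        ‖Complex.cosh (β * w) ^ ((-2 * μ : ℝ) : ℂ) *
          G ((1 / Complex.cosh (β * w) ^ 2) * (-(x : ℂ) ^ 2))‖ ≤
            C * Real.exp (-(2 * μ * β) * |w.re|) := by
  have hstrip : ∀ {w : ℂ}, |w.im| < 1 / (2 * β) → |((β : ℂ) * w).im| < 1 / 2 := fun {w} hw => by
    rw [Complex.im_ofReal_mul, abs_mul, abs_of_pos hβ]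
    calc β * |w.im| < β * (1 / (2 * β)) := by gcongr
      _ = 1 / 2 := by field_simp
  have hlow : ∀ {w : ℂ}, |w.im| < 1 / 2 → 1 / 2 * Real.cosh w.re ≤ ‖Complex.cosh w‖ :=
    fun hw => (cosh_strip hw).1.trans (Complex.re_le_norm _)
  have hpos : ∀ {w : ℂ}, |w.im| < 1 / 2 → 0 < (Complex.cosh w).re := fun {w} hw =>
    (abs_nonneg _).trans_lt (cosh_strip hw).2
  have hsq : (-(x : ℂ) ^ 2) = ((-x ^ 2 : ℝ) : ℂ) := by push_cast; rfl
  -- The arguments of `G` stay in a compact part of the left half-plane, where `G` is bounded; the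
  -- radius 4x² comes from |cosh| ≥ 1/2.
  set K : Set ℂ := Metric.closedBall 0 (4 * x ^ 2) ∩ {z | z.re ≤ 0} with hKdef
  have hK : IsCompact K :=
    (isCompact_closedBall _ _).inter_right (isClosed_le Complex.continuous_re continuous_const)
  have hKs : K ⊆ cutPlane := fun z hz => by
    have h0 : z.re ≤ 0 := hz.2
    refine Or.inl ?_
    rw [Complex.sub_re, Complex.one_re]
    linarith
  have hmem : ∀ {w : ℂ}, |w.im| < 1 / 2 →
      (1 / Complex.cosh w ^ 2) * (-(x : ℂ) ^ 2) ∈ K := fun {w} hw => by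
    rw [hsq]
    constructor
    · have h1 : 1 / 2 ≤ ‖Complex.cosh w‖ := by
        have := hlow hw
        linarith [Real.one_le_cosh w.re]
      rw [mem_closedBall_zero_iff, norm_mul, norm_div, norm_one, norm_pow, Complex.norm_real,
        norm_neg, norm_pow, Real.norm_eq_abs, sq_abs]
      refine mul_le_mul_of_nonneg_right ?_ (sq_nonneg x)
      rw [div_le_iff₀ (by positivity)]
      nlinarith
    · change (_ * _ : ℂ).re ≤ 0
      rw [Complex.re_mul_ofReal]
      nlinarith [re_div_cosh_sq_nonneg hw, sq_nonneg x]
  constructor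
  · intro w hw
    have hw' := hstrip hw
    have h0 : Complex.cosh (β * w) ≠ 0 := fun h => by
      have := hpos hw'
      simp [h] at this
    have hd : DifferentiableAt ℂ G ((1 / Complex.cosh (β * w) ^ 2) * (-(x : ℂ) ^ 2)) :=
      hG.differentiableAt (cutPlane_isOpen.mem_nhds (hKs (hmem hw')))
    have hcd : DifferentiableAt ℂ (fun w : ℂ => Complex.cosh (β * w)) w := by fun_prop
    refine (DifferentiableAt.mul (hcd.cpow_const (Or.inl (hpos hw'))) ?_).differentiableWithinAt
    refine DifferentiableAt.fun_comp' (g := G) w hd ?_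
    exact ((differentiableAt_const _).div (hcd.pow 2) (pow_ne_zero 2 h0)).mul_const _
  · obtain ⟨M, hM⟩ := hK.exists_bound_of_continuousOn (hG.continuousOn.mono hKs)
    -- The power of 4 comes from |cosh(βw)| ≥ e^(β|Re w|)/4: one factor 1/2 from the strip, one from
    -- cosh t ≥ e^|t|/2.
    refine ⟨4 ^ (2 * μ) * M, fun w hw => ?_⟩
    have hw' := hstrip hw
    rw [norm_mul, Complex.norm_cpow_real]
    have h1 : Real.exp (β * |w.re|) / 4 ≤ ‖Complex.cosh (β * w)‖ := by
      have h2 := hlow hw'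
      have h3 := half_exp_abs_le_cosh ((β : ℂ) * w).re
      rw [Complex.re_ofReal_mul] at h2 h3
      rw [abs_mul, abs_of_pos hβ] at h3
      linarith
    have h2 : ‖Complex.cosh (β * w)‖ ^ (-2 * μ) ≤
        4 ^ (2 * μ) * Real.exp (-(2 * μ * β) * |w.re|) := by
      refine (Real.rpow_le_rpow_of_nonpos (by positivity) h1 (by linarith)).trans_eq ?_
      rw [Real.div_rpow (Real.exp_pos _).le (by norm_num), ← Real.exp_mul, neg_mul 2 μ,
        Real.rpow_neg (by norm_num) (2 * μ), div_inv_eq_mul, mul_comm]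
      congr 2
      ring
    calc _ ≤ 4 ^ (2 * μ) * Real.exp (-(2 * μ * β) * |w.re|) * M :=
          mul_le_mul h2 (hM _ (hmem hw')) (norm_nonneg _) (by positivity)
      _ = _ := by ring

/-! ### Assembly -/

open FourierTransform in
-- Substituting v = πt/α turns e^(2iαnv) into e^(2πint); the kernel of `𝓕` is e^(-2πitξ), hence the
-- frequency -n.
theorem integral_exp_mul_eq_fourier {α : ℝ} (hα : 0 < α) (φ : ℝ → ℂ) (n : ℤ) :
    ∫ v : ℝ, Complex.exp (2 * ((α * n : ℝ) : ℂ) * v * Complex.I) * φ v =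
      ((Real.pi / α : ℝ) : ℂ) * 𝓕 (fun t : ℝ => φ (Real.pi / α * t)) ((-n : ℤ) : ℝ) := by
  have hβ : 0 < Real.pi / α := div_pos Real.pi_pos hα
  have h := Measure.integral_comp_mul_left (fun v : ℝ =>
    Complex.exp (2 * ((α * n : ℝ) : ℂ) * v * Complex.I) * φ v) (Real.pi / α)
  rw [abs_of_pos (inv_pos.2 hβ), Complex.real_smul, Complex.ofReal_inv,
    eq_inv_mul_iff_mul_eq₀ (Complex.ofReal_ne_zero.2 hβ.ne')] at h
  rw [← h, Real.fourier_eq']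
  congr 1
  refine integral_congr_ae (ae_of_all _ fun t => ?_)
  simp only [smul_eq_mul]
  congr 2
  have hα' : (α : ℂ) ≠ 0 := Complex.ofReal_ne_zero.2 hα.ne'
  simp
  field_simp

theorem corollary5 (ν x α μ : ℝ) (hν : 0 < ν) (hx : 0 < x) (hα : 0 < α) (hμ : ν / 2 < μ) :
    Summable (fun n : ℤ =>
      ((‖Complex.Gamma ((μ : ℂ) + Complex.I * (α : ℂ) * (n : ℂ))‖ ^ 2 : ℝ) : ℂ) *
        gauss2F1 ((μ : ℂ) + Complex.I * (α : ℂ) * (n : ℂ))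
          ((μ : ℂ) - Complex.I * (α : ℂ) * (n : ℂ)) (ν : ℂ) (-(x : ℂ) ^ 2)) ∧
    Summable (fun n : ℤ =>
      ((1 / Real.cosh (Real.pi * (n : ℝ) / α) ^ (2 * μ) : ℝ) : ℂ) *
        gauss2F1 (μ : ℂ) ((μ : ℂ) + 1 / 2) (ν : ℂ)
          ((-(x ^ 2 / Real.cosh (Real.pi * (n : ℝ) / α) ^ 2) : ℝ) : ℂ)) ∧
    ∑' n : ℤ,
      ((‖Complex.Gamma ((μ : ℂ) + Complex.I * (α : ℂ) * (n : ℂ))‖ ^ 2 : ℝ) : ℂ) *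
        gauss2F1 ((μ : ℂ) + Complex.I * (α : ℂ) * (n : ℂ))
          ((μ : ℂ) - Complex.I * (α : ℂ) * (n : ℂ)) (ν : ℂ) (-(x : ℂ) ^ 2) =
    ((Real.pi / α * (2 : ℝ) ^ (1 - 2 * μ) * Real.Gamma (2 * μ) : ℝ) : ℂ) *
      ∑' n : ℤ,
        ((1 / Real.cosh (Real.pi * (n : ℝ) / α) ^ (2 * μ) : ℝ) : ℂ) *
          gauss2F1 (μ : ℂ) ((μ : ℂ) + 1 / 2) (ν : ℂ)
            ((-(x ^ 2 / Real.cosh (Real.pi * (n : ℝ) / α) ^ 2) : ℝ) : ℂ) := by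
  have hμ0 : 0 < μ := by linarith
  have hβ : 0 < Real.pi / α := div_pos Real.pi_pos hα
  set G := gauss2F1 (μ : ℂ) ((μ : ℂ) + 1 / 2) (ν : ℂ) with hGdef
  have hG : IsGaussContinuation (μ : ℂ) ((μ : ℂ) + 1 / 2) (ν : ℂ) G :=
    isGaussContinuation_gauss2F1 _ (by simp; linarith) (by simpa using hν)
  have hz : -(x : ℂ) ^ 2 ∈ cutPlane := by
    refine Or.inl ?_
    rw [show 1 - -(x : ℂ) ^ 2 = ((1 + x ^ 2 : ℝ) : ℂ) by push_cast; ring, Complex.ofReal_re]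
    positivity
  obtain ⟨hd, C, hC⟩ := sech_profile_strip hG.1 hμ0 hβ x
  obtain ⟨s1, s2, hsum⟩ := poisson_summation_of_strip (by positivity) (by positivity) hd hC
  set φ : ℝ → ℂ := fun v => ((Real.cosh v ^ (-2 * μ) : ℝ) : ℂ) *
    G (((1 / Real.cosh v ^ 2 : ℝ) : ℂ) * -(x : ℂ) ^ 2) with hφdef
  have hφ : ∀ t : ℝ, Complex.cosh (((Real.pi / α : ℝ) : ℂ) * (t : ℂ)) ^ ((-2 * μ : ℝ) : ℂ) *
      G ((1 / Complex.cosh (((Real.pi / α : ℝ) : ℂ) * (t : ℂ)) ^ 2) * (-(x : ℂ) ^ 2)) =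
      φ (Real.pi / α * t) := fun t => by
    rw [hφdef, ← Complex.ofReal_mul, ← Complex.ofReal_cosh]
    simp only
    rw [Complex.ofReal_cpow (Real.cosh_pos _).le]
    push_cast
    rfl
  simp only [hφ] at s1 s2 hsum
  have hR : ∀ n : ℤ, ((1 / Real.cosh (Real.pi * (n : ℝ) / α) ^ (2 * μ) : ℝ) : ℂ) *
      G ((-(x ^ 2 / Real.cosh (Real.pi * (n : ℝ) / α) ^ 2) : ℝ) : ℂ) =
      φ (Real.pi / α * n) := fun n => by
    rw [hφdef, div_mul_eq_mul_div, neg_mul 2 μ]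
    simp only
    rw [Real.rpow_neg (Real.cosh_pos _).le, one_div]
    congr 2
    push_cast
    ring
  have hL : ∀ n : ℤ, ((‖Complex.Gamma ((μ : ℂ) + Complex.I * (α : ℂ) * (n : ℂ))‖ ^ 2 : ℝ) : ℂ) *
      gauss2F1 ((μ : ℂ) + Complex.I * (α : ℂ) * (n : ℂ))
        ((μ : ℂ) - Complex.I * (α : ℂ) * (n : ℂ)) (ν : ℂ) (-(x : ℂ) ^ 2) =
      ((Real.pi / α * (2 : ℝ) ^ (1 - 2 * μ) * Real.Gamma (2 * μ) : ℝ) : ℂ) *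
        FourierTransform.fourier (fun t : ℝ => φ (Real.pi / α * t)) ((-n : ℤ) : ℝ) := fun n => by
    have h := norm_Gamma_sq_mul_gauss2F1 hμ0 (c := (ν : ℂ)) (by simpa using hν) (α * n) hz
    simp only [mul_assoc (Complex.exp _)] at h
    rw [integral_exp_mul_eq_fourier hα φ n] at h
    rw [show Complex.I * (α : ℂ) * (n : ℂ) = Complex.I * ((α * n : ℝ) : ℂ) by push_cast; ring, h]
    push_cast
    ring
  simp only [hR, hL]
  -- Reindexing by n ↦ -n absorbs the sign of the frequency.
  have s2' := (Equiv.neg ℤ).summable_iff.2 s2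
  refine ⟨s2'.mul_left _, s1, ?_⟩
  rw [tsum_mul_left, hsum]
  congr 1
  exact (Equiv.neg ℤ).tsum_eq fun n : ℤ =>
    FourierTransform.fourier (fun t : ℝ => φ (Real.pi / α * t)) (n : ℝ)
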